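/- Consider two queues in discrete time (the two links of an ad hoc wireless network). The set $\mathcal S$ of feasible service vectors is $\{(1,0),(0,1),(\tfrac23,\tfrac23)\}$, possibly enlarged by some or all of the coordinate projections of these vectors. For each $\epsilon\in(0,1)$ consider the following system. In time slot $k$, given the queue lengths $q^{(\epsilon)}(k)\in\mathbb R_+^2$, a service vector $s^{(\epsilon)}(k)\in\arg\max_{x\in\mathcal S}\langle q^{(\epsilon)}(k),x\rangle$ is chosen (MaxWeight; ties are broken at random, by any rule depending on $q^{(\epsilon)}(k)$), then a vector $a^{(\epsilon)}(k)\in\mathbb Z_+^2$ of arrivals occurs, and $q^{(\epsilon)}_i(k+1)=\max\{q^{(\epsilon)}_i(k)+a^{(\epsilon)}_i(k)-s^{(\epsilon)}_i(k),0\}$ for $i=1,2$. The vectors $a^{(\epsilon)}(k)$, $k\ge 0$, are i.i.d., and $a^{(\epsilon)}(k)$ is independent of the queue lengths and service vectors up to slot $k$; the two coordinates may be correlated. Assume that $a_i^{(\epsilon)}(k)\le A_{\max}$ almost surely with a constant $A_{\max}$ independent of $\epsilon$, that $\mathbb E[a^{(\epsilon)}(k)]=(1-\epsilon)\nu$ with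 $\nu=\tfrac23(1,1)$, and that $\operatorname{Var}(a_i^{(\epsilon)}(k))\to\sigma_i^2$ as $\epsilon\downarrow0$ for $i=1,2$. Then for every $\epsilon\in(0,1)$ the Markov chain $\{q^{(\epsilon)}(k)\}_{k\ge 0}$ has a stationary distribution, and for every choice of random vectors $\overline q^{(\epsilon)}$ distributed according to a stationary distribution of the $\epsilon$-th chain, $\overline q^{(\epsilon)}_1$ and $\overline q^{(\epsilon)}_2$ are integrable and $$\lim_{\epsilon\downarrow0}\epsilon\,\mathbb E\bigl[\overline q^{(\epsilon)}_1+\overline q^{(\epsilon)}_2\bigr]=\tfrac34\bigl(\sigma_1^2+\sigma_2^2\bigr).$$ -/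

import Mathlib

open MeasureTheory ProbabilityTheory Filter Set
open scoped Topology

noncomputable section

/-- The maximal-weight schedules: the maximizers over `S` of the dot product `⟨q, x⟩`. -/
def maxWeightSchedules {n : ℕ} (S : Set (Fin n → ℝ)) (q : Fin n → ℝ) : Set (Fin n → ℝ) :=
  {x | x ∈ S ∧ ∀ y ∈ S, q ⬝ᵥ y ≤ q ⬝ᵥ x}

/-- A randomized scheduling rule: `τ q` is the law of the potential service vector when the queue
lengths are `q`. It is a MaxWeight rule for `S` if it always selects a maximal-weight schedule;
ties are broken at random in an arbitrary way. -/
def IsMaxWeight {n : ℕ} (S : Set (Fin n → ℝ)) (τ : Kernel (Fin n → ℝ) (Fin n → ℝ)) : Prop :=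
  ∀ q : Fin n → ℝ, 0 ≤ q → ∀ᵐ s ∂(τ q), s ∈ maxWeightSchedules S q

/-- Unused service: potential service minus the amount of work that is actually processed, which
is the minimum of the potential service and of the work available (in line or just arrived). -/
def unusedService {n : ℕ} (q : Fin n → ℝ) (a : Fin n → ℕ) (s : Fin n → ℝ) : Fin n → ℝ :=
  fun i => s i - min (s i) (q i + (a i : ℝ))

/-- Queue lengths at the beginning of the next time slot: `q + a - s + u`. -/
def nextQueue {n : ℕ} (q : Fin n → ℝ) (a : Fin n → ℕ) (s : Fin n → ℝ) : Fin n → ℝ :=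
  fun i => q i + (a i : ℝ) - s i + unusedService q a s i

theorem measurable_nextQueue {n : ℕ} :
    Measurable (fun p : (Fin n → ℝ) × (Fin n → ℝ) × (Fin n → ℕ) =>
      nextQueue p.1 p.2.2 p.2.1) := by
  have hc : Measurable (fun m : ℕ => (m : ℝ)) := measurable_from_top
  unfold nextQueue unusedService
  refine measurable_pi_lambda _ fun i => ?_
  have h1 : Measurable (fun p : (Fin n → ℝ) × (Fin n → ℝ) × (Fin n → ℕ) => p.1 i) :=
    (measurable_pi_apply i).comp measurable_fst
  have h2 : Measurable (fun p : (Fin n → ℝ) × (Fin n → ℝ) × (Fin n → ℕ) => p.2.1 i) :=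
    (measurable_pi_apply i).comp (measurable_fst.comp measurable_snd)
  have h3 : Measurable (fun p : (Fin n → ℝ) × (Fin n → ℝ) × (Fin n → ℕ) => (p.2.2 i : ℝ)) :=
    hc.comp ((measurable_pi_apply i).comp (measurable_snd.comp measurable_snd))
  exact ((h1.add h3).sub h2).add (h2.sub (h2.min (h1.add h3)))

/-- One-step transition kernel of the queue length chain: given `q`, a schedule `s` is drawn from
`τ q`, the arrivals `a` are drawn from `α` independently of `(q, s)`, and the chain moves to
`nextQueue q a s`. -/
def queueKernel {n : ℕ} (α : Measure (Fin n → ℕ)) (τ : Kernel (Fin n → ℝ) (Fin n → ℝ)) :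
    Kernel (Fin n → ℝ) (Fin n → ℝ) :=
  (Kernel.id ×ₖ (τ ×ₖ Kernel.const (Fin n → ℝ) α)).map (fun p => nextQueue p.1 p.2.2 p.2.1)

theorem queueKernel_apply {n : ℕ} (α : Measure (Fin n → ℕ)) [IsProbabilityMeasure α]
    (τ : Kernel (Fin n → ℝ) (Fin n → ℝ)) [IsMarkovKernel τ] (q : Fin n → ℝ) :
    queueKernel α τ q =
      ((τ q).prod α).map (fun p : (Fin n → ℝ) × (Fin n → ℕ) => nextQueue q p.2 p.1) := by
  unfold queueKernel
  rw [Kernel.map_apply _ measurable_nextQueue, Kernel.prod_apply, Kernel.prod_apply,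
    Kernel.id_apply, Kernel.const_apply, Measure.dirac_prod,
    Measure.map_map measurable_nextQueue measurable_prodMk_left]
  rfl

/-- `π` is a steady-state distribution of the chain with transition kernel `κ`. -/
def IsSteadyState {n : ℕ} (κ : Kernel (Fin n → ℝ) (Fin n → ℝ)) (π : Measure (Fin n → ℝ)) : Prop :=
  IsProbabilityMeasure π ∧ κ.Invariant π

/-- The vectors of `S` together with all their projections on coordinate subspaces. -/
def withProjections {n : ℕ} (S : Set (Fin n → ℝ)) : Set (Fin n → ℝ) :=
  {x | ∃ y ∈ S, ∀ i, x i = y i ∨ x i = 0}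

/-- The schedules of the two-link ad hoc network. -/
def adHocSchedules : Set (Fin 2 → ℝ) :=
  {![1, 0], ![0, 1], ![2 / 3, 2 / 3]}

end

/-! The point `ν` is a vertex of the capacity region, and its normal cone `q 0 ≤ 2 * q 1`, `q 1 ≤ 2
* q 0` has full dimension. In that cone `(2/3, 2/3)` has maximal weight; strictly outside it
MaxWeight serves only the longer queue, so the total service drops from 4/3 to 1.

In steady state, flow balance (`deficit_add_unused`) makes the mean service deficit plus the mean
unused service equal to `4/3 * ε`. Both are nonnegative, so each is O(ε), and hence so are the
probability of being outside the cone and the second moments of the unused service and of the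
service about its target. Next, the squared excess `max (q i - 2 * q j) 0 ^ 2` has a negative drift
proportional to the excess, and its second-order part acts only when the excess is positive before
or after the step. This makes the mean excess O(ε) (`integral_excess_le`).

Finally, the balance of `q i ^ 2` (`sq_balance`) is summed over the two queues. The weight of the
chosen service exceeds `2/3 * (q 0 + q 1)` by at most a third of the two excesses, so everything
except `4/3 * ε * E(q 0 + q 1)` and the two variances is O(ε). The coordinates are squared
separately, so the correlation of the arrivals plays no role.

The quadratic test functions need not be integrable: `integral_sub_eq_zero_of_map_eq` asks only for
integrable increments, which finite first moments provide. These moments come from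
`lintegral_le_of_drift`. Existence of a stationary law is obtained on the lattice of multiples of
1/3, a countable set that the chain never leaves. -/

/-! ### Drift conditions and stationary laws for general Markov chains. -/

/-- A Foster–Lyapunov drift condition bounds the mean of the drift under an invariant law, even if
the Lyapunov function is not integrable. -/
theorem lintegral_le_of_drift {E : Type*} [MeasurableSpace E] {κ : Kernel E E} [IsMarkovKernel κ]
    {π : Measure E} [IsProbabilityMeasure π] (hπ : κ.Invariant π) {V f : E → ENNReal}
    (hV : Measurable V) (hf : Measurable f) (hVtop : ∀ x, V x ≠ ⊤) {b : ENNReal}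
    (h : ∀ᵐ x ∂π, ∫⁻ y, V y ∂(κ x) + f x ≤ V x + b) : ∫⁻ x, f x ∂π ≤ b := by
  have hW (M : ℕ) : Measurable fun x => min (V x) (M : ENNReal) := hV.min measurable_const
  have hset (M : ℕ) : MeasurableSet {x | V x ≤ (M : ENNReal)} :=
    measurableSet_le hV measurable_const
  -- Truncating `V` at `M` preserves the drift inequality if `f` is kept only on `{V ≤ M}`; the
  -- truncated integral is finite and can be cancelled.
  have key (M : ℕ) : ∫⁻ x, indicator {x | V x ≤ (M : ENNReal)} f x ∂π ≤ b := by
    have h1 : ∀ᵐ x ∂π, ∫⁻ y, min (V y) (M : ENNReal) ∂(κ x) +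
        indicator {x | V x ≤ (M : ENNReal)} f x ≤ min (V x) (M : ENNReal) + b := by
      filter_upwards [h] with x hx
      by_cases hx' : V x ≤ (M : ENNReal)
      · rw [indicator_of_mem (show x ∈ {x | V x ≤ (M : ENNReal)} from hx'), min_eq_left hx']
        exact le_trans (by gcongr; exact min_le_left _ _) hx
      · rw [indicator_of_notMem (show x ∉ {x | V x ≤ (M : ENNReal)} from hx'), add_zero,
          min_eq_right (not_le.mp hx').le]
        calc ∫⁻ y, min (V y) (M : ENNReal) ∂(κ x) ≤ ∫⁻ _, (M : ENNReal) ∂(κ x) :=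
              lintegral_mono fun y => min_le_right _ _
          _ = M := by simp
          _ ≤ M + b := le_self_add
    have h2 := lintegral_mono_ae h1
    rw [lintegral_add_right _ (hf.indicator (hset M)), lintegral_add_right _ measurable_const,
      ← Measure.lintegral_bind κ.measurable.aemeasurable (hW M).aemeasurable] at h2
    rw [show π.bind κ = π from hπ] at h2
    have hfin : ∫⁻ x, min (V x) (M : ENNReal) ∂π ≠ ⊤ := by
      refine ne_top_of_le_ne_top (ENNReal.natCast_ne_top M) ?_
      calc ∫⁻ x, min (V x) (M : ENNReal) ∂π ≤ ∫⁻ _, (M : ENNReal) ∂π :=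
            lintegral_mono fun y => min_le_right _ _
        _ = M := by simp
    simpa using (ENNReal.add_le_add_iff_left hfin).mp h2
  have hmono : Monotone fun (M : ℕ) x => indicator {x | V x ≤ (M : ENNReal)} f x := by
    intro M N hMN x
    refine indicator_le_indicator_of_subset (fun x hx => ?_) (fun _ => zero_le) x
    exact le_trans (mem_ofPred.mp hx) (by exact_mod_cast hMN)
  have hsup : ∀ x, f x = ⨆ M : ℕ, indicator {x | V x ≤ (M : ENNReal)} f x := by
    intro x
    apply le_antisymm
    · obtain ⟨M, hM⟩ := ENNReal.exists_nat_gt (hVtop x)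
      refine le_trans ?_ (le_iSup _ M)
      rw [indicator_of_mem (show x ∈ {x | V x ≤ (M : ENNReal)} from hM.le)]
    · exact iSup_le fun M => indicator_le_self' (fun _ _ => zero_le) x
  simp_rw [lintegral_congr hsup]
  rw [lintegral_iSup (fun M => hf.indicator (hset M)) hmono]
  exact iSup_le key

/-- Integrable increments between two identically distributed variables have mean zero. -/
theorem integral_sub_eq_zero_of_map_eq {Ω E : Type*} [MeasurableSpace Ω] [MeasurableSpace E]
    {P : Measure Ω} [IsProbabilityMeasure P] {X Y : Ω → E} (hX : Measurable X) (hY : Measurable Y)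
    (hXY : P.map X = P.map Y) {V : E → ℝ} (hV : Measurable V)
    (hint : Integrable (fun ω => V (Y ω) - V (X ω)) P) :
    ∫ ω, (V (Y ω) - V (X ω)) ∂P = 0 := by
  set T : ℕ → ℝ → ℝ := fun M v => max (-(M : ℝ)) (min v M) with hT
  have hTm (M : ℕ) : Measurable (T M) :=
    measurable_const.max (measurable_id.min measurable_const)
  have hTb (M : ℕ) (v : ℝ) : |T M v| ≤ M := by
    have : (0 : ℝ) ≤ M := M.cast_nonneg
    exact abs_le.mpr ⟨le_max_left _ _, max_le (by linarith) (min_le_right _ _)⟩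
  have hTint (M : ℕ) {Z : Ω → E} (hZ : Measurable Z) : Integrable (fun ω => T M (V (Z ω))) P :=
    Integrable.of_bound ((hTm M).comp (hV.comp hZ)).aestronglyMeasurable M
      (Eventually.of_forall fun ω => hTb M _)
  have hzero (M : ℕ) : ∫ ω, (T M (V (Y ω)) - T M (V (X ω))) ∂P = 0 := by
    rw [integral_sub (hTint M hY) (hTint M hX)]
    have hm : AEStronglyMeasurable (fun x => T M (V x)) (P.map X) :=
      ((hTm M).comp hV).aestronglyMeasurable
    rw [← integral_map hX.aemeasurable hm, hXY,
      integral_map hY.aemeasurable (hXY ▸ hm), sub_self]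
  -- Truncation is 1-Lipschitz, so the increment of `V` itself dominates the truncated increments.
  have hlim : Tendsto (fun M : ℕ => ∫ ω, (T M (V (Y ω)) - T M (V (X ω))) ∂P) atTop
      (𝓝 (∫ ω, (V (Y ω) - V (X ω)) ∂P)) := by
    refine tendsto_integral_of_dominated_convergence (fun ω => |V (Y ω) - V (X ω)|)
      (fun M => ((hTint M hY).sub (hTint M hX)).aestronglyMeasurable) hint.abs
      (fun M => Eventually.of_forall fun ω => ?_) (Eventually.of_forall fun ω => ?_)
    · refine (abs_max_sub_max_le_max _ _ _ _).trans ?_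
      refine max_le (by simp) ((abs_min_sub_min_le_max _ _ _ _).trans ?_)
      simp
    · refine tendsto_const_nhds.congr' ?_
      obtain ⟨N, hN⟩ := exists_nat_ge (max |V (Y ω)| |V (X ω)|)
      filter_upwards [eventually_ge_atTop N] with M hM
      have hM' : max |V (Y ω)| |V (X ω)| ≤ M := hN.trans (by exact_mod_cast hM)
      have h1 := abs_le.mp ((le_max_left _ _).trans hM')
      have h2 := abs_le.mp ((le_max_right _ _).trans hM')
      simp only [hT]
      rw [min_eq_left h1.2, min_eq_left h2.2, max_eq_right h1.1, max_eq_right h2.1]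
  exact tendsto_nhds_unique hlim (by simp [hzero])

/-- A Markov chain on a countable space satisfying a Foster–Lyapunov drift condition whose drift
has finite sublevel sets has a stationary distribution. -/
theorem exists_invariant_of_drift {X : Type*} [Countable X] [MeasurableSpace X]
    [MeasurableSingletonClass X] (κ : Kernel X X) [IsMarkovKernel κ] (x₀ : X) {V f : X → ENNReal}
    (hV₀ : V x₀ ≠ ⊤) {b : ENNReal} (hb : b ≠ ⊤)
    (h : ∀ x, ∫⁻ y, V y ∂(κ x) + f x ≤ V x + b)
    (hfin : ∀ R : ℕ, {x | f x ≤ R}.Finite) :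
    ∃ π : Measure X, IsProbabilityMeasure π ∧ κ.Invariant π := by
  classical
  have hmeas : ∀ g : X → ENNReal, Measurable g := fun g => measurable_of_countable g
  -- laws of the chain started at `x₀`, and their Cesàro averages
  obtain ⟨μ, hμ0, hμs⟩ : ∃ μ : ℕ → Measure X, μ 0 = Measure.dirac x₀ ∧
      ∀ n, μ (n + 1) = (μ n).bind κ :=
    ⟨fun n => Nat.rec (Measure.dirac x₀) (fun _ m => m.bind κ) n, rfl, fun _ => rfl⟩
  have hμp (n : ℕ) : IsProbabilityMeasure (μ n) := by
    induction n with
    | zero => rw [hμ0]; infer_instance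
    | succ n ih => rw [hμs]; infer_instance
  let c : ℕ → Measure X := fun n => ((n : ENNReal) + 1)⁻¹ • ∑ k ∈ Finset.range (n + 1), μ k
  have hn0 (n : ℕ) : ((n : ENNReal) + 1) ≠ 0 := by simp
  have hnt (n : ℕ) : ((n : ENNReal) + 1) ≠ ⊤ := by simp
  have hcp (n : ℕ) : IsProbabilityMeasure (c n) := by
    constructor
    simp only [c, Measure.smul_apply, Measure.finsetSum_apply, measure_univ, smul_eq_mul]
    simp only [Finset.sum_const, Finset.card_range, nsmul_eq_mul, mul_one, Nat.cast_add,
      Nat.cast_one]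
    exact ENNReal.inv_mul_cancel (hn0 n) (hnt n)
  -- drift bound for the averages
  have hsum (n : ℕ) : ∫⁻ x, V x ∂(μ n) + ∑ k ∈ Finset.range n, ∫⁻ x, f x ∂(μ k)
      ≤ V x₀ + n * b := by
    induction n with
    | zero => simp [hμ0]
    | succ n ih =>
      have h1 : ∫⁻ x, V x ∂(μ (n + 1)) + ∫⁻ x, f x ∂(μ n) ≤ ∫⁻ x, V x ∂(μ n) + b := by
        rw [hμs, Measure.lintegral_bind κ.measurable.aemeasurable (hmeas V).aemeasurable,
          ← lintegral_add_right _ (hmeas f)]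
        refine (lintegral_mono h).trans ?_
        rw [lintegral_add_right _ measurable_const]
        simp
      rw [Finset.sum_range_succ]
      calc _ = (∫⁻ x, V x ∂(μ (n + 1)) + ∫⁻ x, f x ∂(μ n))
              + ∑ k ∈ Finset.range n, ∫⁻ x, f x ∂(μ k) := by ring
        _ ≤ (∫⁻ x, V x ∂(μ n) + b) + ∑ k ∈ Finset.range n, ∫⁻ x, f x ∂(μ k) := by gcongr
        _ = (∫⁻ x, V x ∂(μ n) + ∑ k ∈ Finset.range n, ∫⁻ x, f x ∂(μ k)) + b := by ring
        _ ≤ (V x₀ + n * b) + b := by gcongr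
        _ = _ := by push_cast; ring
  have hcf (n : ℕ) : ∫⁻ x, f x ∂(c n) ≤ V x₀ + b := by
    simp only [c, lintegral_smul_measure, lintegral_finsetSum_measure, smul_eq_mul]
    rw [ENNReal.inv_mul_le_iff (hn0 n) (hnt n)]
    refine (le_add_self.trans (hsum (n + 1))).trans ?_
    push_cast
    rw [mul_add]
    gcongr
    exact le_mul_of_one_le_left (zero_le) le_add_self
  -- the limit of the averages along an ultrafilter
  have hlim (A : Set X) : ∃ m, Tendsto (fun n => c n A) (hyperfilter ℕ) (𝓝 m) := by
    obtain ⟨m, -, hm⟩ := (isCompact_univ (X := ENNReal)).ultrafilter_le_nhds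
      ((hyperfilter ℕ).map fun n => c n A) (by simp)
    exact ⟨m, hm⟩
  choose m hm using hlim
  have hU : (hyperfilter ℕ : Filter ℕ) ≤ atTop := by
    rw [← Nat.cofinite_eq_atTop]; exact hyperfilter_le_cofinite
  -- The limit `m` is a priori only finitely additive; `π` keeps its point masses, and full mass has
  -- to be recovered by tightness.
  let π : Measure X := Measure.sum fun x => m {x} • Measure.dirac x
  have hπs (y : X) : π {y} = m {y} := by
    simp only [π, Measure.sum_apply _ (measurableSet_singleton y), Measure.smul_apply,
      smul_eq_mul]
    rw [tsum_eq_single y]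
    · simp
    · intro x hx
      simp [hx]
  have hπf (F : Finset X) : Tendsto (fun n => c n F) (hyperfilter ℕ) (𝓝 (π F)) := by
    have h1 : ∀ ν : Measure X, ν F = ∑ x ∈ F, ν {x} := fun ν => sum_measure_singleton.symm
    simp_rw [h1, hπs]
    exact tendsto_finsetSum _ fun x _ => hm {x}
  have hπle : π univ ≤ 1 := by
    simp only [π, Measure.sum_apply _ MeasurableSet.univ, Measure.smul_apply, measure_univ,
      smul_eq_mul, mul_one]
    refine ENNReal.summable.tsum_le_of_sum_le fun F => ?_
    have h1 : ∑ x ∈ F, m {x} = π F := by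
      rw [← sum_measure_singleton]; simp_rw [hπs]
    rw [h1]
    exact le_of_tendsto (hπf F) (Eventually.of_forall fun n => prob_le_one)
  have hK : V x₀ + b ≠ ⊤ := ENNReal.add_ne_top.mpr ⟨hV₀, hb⟩
  -- Tightness: by Markov's inequality the averages put mass at most `(V x₀ + b) / (R + 1)` outside
  -- a finite sublevel set of `f`.
  have hπge (R : ℕ) : 1 ≤ π univ + (V x₀ + b) / ((R : ENNReal) + 1) := by
    have h1 (n : ℕ) : 1 ≤ c n ((hfin (R + 1)).toFinset : Set X)
        + (V x₀ + b) / ((R : ENNReal) + 1) := by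
      rw [Finite.coe_toFinset]
      refine (measure_univ (μ := c n)).symm.le.trans ?_
      refine (measure_mono (t := {x | f x ≤ ((R + 1 : ℕ) : ENNReal)} ∪
        {x | ((R : ENNReal) + 1) ≤ f x}) fun x _ => ?_).trans ((measure_union_le _ _).trans ?_)
      · rcases le_total (f x) ((R + 1 : ℕ) : ENNReal) with h | h
        · exact Or.inl h
        · exact Or.inr (by simpa using h)
      · gcongr
        refine (meas_ge_le_lintegral_div (hmeas f).aemeasurable (hn0 R) (hnt R)).trans ?_
        gcongr
        exact hcf n
    refine (ge_of_tendsto ((hπf _).add_const _) (Eventually.of_forall h1)).trans ?_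
    gcongr
    exact subset_univ _
  have hπ1 : π univ = 1 := by
    refine le_antisymm hπle ?_
    have h1 : Tendsto (fun R : ℕ => π univ + (V x₀ + b) / ((R : ENNReal) + 1)) atTop
        (𝓝 (π univ + 0)) := by
      refine Tendsto.const_add _ ?_
      have h2 := ENNReal.Tendsto.const_mul (a := V x₀ + b)
        (ENNReal.tendsto_inv_nat_nhds_zero.comp (tendsto_add_atTop_nat 1)) (Or.inr hK)
      simpa [div_eq_mul_inv, Function.comp_def] using h2
    simpa using ge_of_tendsto h1 (Eventually.of_forall hπge)
  have hπp : IsProbabilityMeasure π := ⟨hπ1⟩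
  refine ⟨π, hπp, ?_⟩
  -- invariance
  have hstep (n : ℕ) (y : X) : (c n).bind κ {y} ≤ c n {y} + ((n : ENNReal) + 1)⁻¹ := by
    -- Shifting the Cesàro sum by one step changes it only by its two end terms.
    have h1 : ∑ k ∈ Finset.range (n + 1), μ (k + 1) {y}
        ≤ ∑ k ∈ Finset.range (n + 1), μ k {y} + 1 := by
      have h2 : ∑ k ∈ Finset.range (n + 1), μ (k + 1) {y} + μ 0 {y}
          = ∑ k ∈ Finset.range (n + 1), μ k {y} + μ (n + 1) {y} := by
        rw [← Finset.sum_range_succ' (fun k => μ k {y}), Finset.sum_range_succ]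
      refine le_self_add.trans (h2.le.trans ?_)
      gcongr
      exact prob_le_one
    rw [Measure.bind_apply (measurableSet_singleton y) κ.measurable.aemeasurable]
    simp only [c, lintegral_smul_measure, lintegral_finsetSum_measure, smul_eq_mul,
      Measure.smul_apply, Measure.finsetSum_apply]
    have h3 (k : ℕ) : ∫⁻ x, κ x {y} ∂(μ k) = μ (k + 1) {y} := by
      rw [hμs, Measure.bind_apply (measurableSet_singleton y) κ.measurable.aemeasurable]
    simp_rw [h3]
    refine (mul_le_mul_right h1 _).trans ?_
    rw [mul_add, mul_one]
  -- Finite partial sums pass to the limit and give only subinvariance; equality follows because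
  -- both measures have mass one.
  have hle : π.bind κ ≤ π := by
    have hpt (y : X) : π.bind κ {y} ≤ π {y} := by
      rw [Measure.bind_apply (measurableSet_singleton y) κ.measurable.aemeasurable]
      simp only [π, lintegral_sum_measure, lintegral_smul_measure, lintegral_dirac, smul_eq_mul]
      refine (ENNReal.summable.tsum_le_of_sum_le fun F => ?_).trans (hπs y).ge
      have h1 : Tendsto (fun n => ∑ x ∈ F, c n {x} * κ x {y}) (hyperfilter ℕ)
          (𝓝 (∑ x ∈ F, m {x} * κ x {y})) :=
        tendsto_finsetSum _ fun x _ =>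
          ENNReal.Tendsto.mul_const (hm {x}) (Or.inr (measure_ne_top _ _))
      have h2 : Tendsto (fun n : ℕ => c n {y} + ((n : ENNReal) + 1)⁻¹) (hyperfilter ℕ)
          (𝓝 (m {y} + 0)) := by
        refine (hm {y}).add (Tendsto.mono_left ?_ hU)
        simpa [Function.comp_def] using
          ENNReal.tendsto_inv_nat_nhds_zero.comp (tendsto_add_atTop_nat 1)
      rw [add_zero] at h2
      refine le_of_tendsto_of_tendsto' h1 h2 fun n => ?_
      refine le_trans ?_ (hstep n y)
      rw [Measure.bind_apply (measurableSet_singleton y) κ.measurable.aemeasurable]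
      rw [lintegral_countable']
      simp_rw [mul_comm (c n _)]
      exact ENNReal.sum_le_tsum F
    refine Measure.le_iff.mpr fun A _ => ?_
    have hA : ∀ ν : Measure X, ν A = ∑' y : A, ν {(y : X)} := fun ν =>
      by
        rw [← measure_biUnion A.to_countable (fun x _ y _ hxy => by simpa using hxy)
          (fun x _ => measurableSet_singleton x), biUnion_of_singleton]
    rw [hA, hA]
    exact ENNReal.tsum_le_tsum fun y => hpt y
  have : IsProbabilityMeasure (π.bind κ) := inferInstance
  exact Measure.eq_of_le_of_measure_univ_eq hle (by simp)

/-! ### Queue dynamics and unused service. -/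

theorem nextQueue_apply {n : ℕ} (q : Fin n → ℝ) (a : Fin n → ℕ) (s : Fin n → ℝ) (i : Fin n) :
    nextQueue q a s i = max (q i + a i - s i) 0 := by
  unfold nextQueue unusedService
  rcases le_total (s i) (q i + a i) with h | h
  · rw [min_eq_left h, max_eq_left (by linarith)]; ring
  · rw [min_eq_right h, max_eq_right (by linarith)]; ring

theorem nextQueue_nonneg {n : ℕ} (q : Fin n → ℝ) (a : Fin n → ℕ) (s : Fin n → ℝ) :
    0 ≤ nextQueue q a s := fun i => by rw [nextQueue_apply]; exact le_max_right _ _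

theorem nextQueue_apply_eq_add {n : ℕ} (q : Fin n → ℝ) (a : Fin n → ℕ) (s : Fin n → ℝ)
    (i : Fin n) : nextQueue q a s i = q i + a i - s i + unusedService q a s i := rfl

theorem unusedService_nonneg {n : ℕ} (q : Fin n → ℝ) (a : Fin n → ℕ) (s : Fin n → ℝ)
    (i : Fin n) : 0 ≤ unusedService q a s i := sub_nonneg.mpr (min_le_left _ _)

theorem unusedService_le {n : ℕ} {q : Fin n → ℝ} (a : Fin n → ℕ) {s : Fin n → ℝ}
    (hq : 0 ≤ q) (i : Fin n) (hs : 0 ≤ s i) : unusedService q a s i ≤ s i := by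
  have h1 : (0 : ℝ) ≤ a i := Nat.cast_nonneg _
  have h2 : 0 ≤ q i := hq i
  have : 0 ≤ min (s i) (q i + a i) := le_min hs (by linarith)
  unfold unusedService
  linarith

/-- Complementarity: unused service only occurs when the queue empties. -/
theorem nextQueue_mul_unusedService {n : ℕ} (q : Fin n → ℝ) (a : Fin n → ℕ) (s : Fin n → ℝ)
    (i : Fin n) : nextQueue q a s i * unusedService q a s i = 0 := by
  rw [nextQueue_apply]
  unfold unusedService
  rcases le_total (s i) (q i + a i) with h | h
  · rw [min_eq_left h]; ring
  · rw [max_eq_right (by linarith)]; ring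

theorem measurable_unusedService {n : ℕ} (i : Fin n) :
    Measurable fun ω : ((Fin n → ℝ) × (Fin n → ℝ)) × (Fin n → ℕ) =>
      unusedService ω.1.1 ω.2 ω.1.2 i := by
  have hc : Measurable (fun m : ℕ => (m : ℝ)) := measurable_from_top
  unfold unusedService
  fun_prop

theorem measurable_nextQueue_assoc {n : ℕ} :
    Measurable fun ω : ((Fin n → ℝ) × (Fin n → ℝ)) × (Fin n → ℕ) =>
      nextQueue ω.1.1 ω.2 ω.1.2 :=
  measurable_nextQueue.comp
    ((measurable_fst.comp measurable_fst).prodMk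
      ((measurable_snd.comp measurable_fst).prodMk measurable_snd))

/-! ### Geometry of MaxWeight around the normal cone. -/

/-- The service vector `s` is one of the schedules of the two-link ad hoc network or one of their
projections, and its weight is at least that of each of the three schedules. -/
def DominatesAdHoc (q s : Fin 2 → ℝ) : Prop :=
  ((s 0 = 1 ∧ s 1 = 0) ∨ (s 0 = 0 ∧ s 1 = 1) ∨ (s 0 = 2 / 3 ∧ s 1 = 2 / 3) ∨
    (s 0 = 2 / 3 ∧ s 1 = 0) ∨ (s 0 = 0 ∧ s 1 = 2 / 3) ∨ (s 0 = 0 ∧ s 1 = 0)) ∧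
  q 0 ≤ q 0 * s 0 + q 1 * s 1 ∧ q 1 ≤ q 0 * s 0 + q 1 * s 1 ∧
  2 / 3 * (q 0 + q 1) ≤ q 0 * s 0 + q 1 * s 1

theorem dominatesAdHoc_of_mem {S : Set (Fin 2 → ℝ)} (hS : adHocSchedules ⊆ S)
    (hS' : S ⊆ withProjections adHocSchedules) {q s : Fin 2 → ℝ}
    (hs : s ∈ maxWeightSchedules S q) : DominatesAdHoc q s := by
  obtain ⟨hsS, hmax⟩ := hs
  refine ⟨?_, ?_, ?_, ?_⟩
  · obtain ⟨y, hy, h⟩ := hS' hsS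
    have h0 := h 0
    have h1 := h 1
    simp only [adHocSchedules, mem_insert_iff, mem_singleton_iff] at hy
    rcases hy with rfl | rfl | rfl <;> simp at h0 h1 <;> tauto
  · have := hmax _ (hS (show ![1, 0] ∈ adHocSchedules by simp [adHocSchedules]))
    simpa [dotProduct, Fin.sum_univ_two] using this
  · have := hmax _ (hS (show ![0, 1] ∈ adHocSchedules by simp [adHocSchedules]))
    simpa [dotProduct, Fin.sum_univ_two] using this
  · have := hmax _ (hS (show ![2 / 3, 2 / 3] ∈ adHocSchedules by simp [adHocSchedules]))
    simp only [dotProduct, Fin.sum_univ_two, Matrix.cons_val_zero, Matrix.cons_val_one] at this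
    linarith

/-- Joint measurability is what allows a property of almost every `s` given `q` to be transferred to
the joint law `π ⊗ₘ τ`. -/
theorem measurableSet_dominatesAdHoc :
    MeasurableSet {p : (Fin 2 → ℝ) × (Fin 2 → ℝ) | 0 ≤ p.1 ∧ DominatesAdHoc p.1 p.2} := by
  unfold DominatesAdHoc
  have hs (i : Fin 2) : Measurable fun p : (Fin 2 → ℝ) × (Fin 2 → ℝ) => p.2 i := by fun_prop
  have hq (i : Fin 2) : Measurable fun p : (Fin 2 → ℝ) × (Fin 2 → ℝ) => p.1 i := by fun_prop
  have hsc (i : Fin 2) (c : ℝ) :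
      MeasurableSet {p : (Fin 2 → ℝ) × (Fin 2 → ℝ) | p.2 i = c} :=
    measurableSet_eq_fun (hs i) measurable_const
  have hw : Measurable fun p : (Fin 2 → ℝ) × (Fin 2 → ℝ) => p.1 0 * p.2 0 + p.1 1 * p.2 1 := by
    fun_prop
  have hc (c d : ℝ) := (hsc 0 c).inter (hsc 1 d)
  refine MeasurableSet.inter (measurableSet_le measurable_const measurable_fst)
    (MeasurableSet.inter ?_ (MeasurableSet.inter (measurableSet_le (hq 0) hw)
      (MeasurableSet.inter (measurableSet_le (hq 1) hw)
        (measurableSet_le (by fun_prop) hw))))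
  exact (hc _ _).union ((hc _ _).union ((hc _ _).union ((hc _ _).union
    ((hc _ _).union (hc _ _)))))

namespace DominatesAdHoc

variable {q s : Fin 2 → ℝ}

theorem nonneg (h : DominatesAdHoc q s) (i : Fin 2) : 0 ≤ s i := by
  obtain ⟨h, -⟩ := h
  fin_cases i <;> rcases h with h | h | h | h | h | h <;> norm_num [h.1, h.2]

theorem le_one (h : DominatesAdHoc q s) (i : Fin 2) : s i ≤ 1 := by
  obtain ⟨h, -⟩ := h
  fin_cases i <;> rcases h with h | h | h | h | h | h <;> norm_num [h.1, h.2]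

theorem sum_le (h : DominatesAdHoc q s) : s 0 + s 1 ≤ 4 / 3 := by
  obtain ⟨h, -⟩ := h
  rcases h with h | h | h | h | h | h <;> norm_num [h.1, h.2]

/-- Only `(2/3, 2/3)` has zero deficit; every other vector has deficit at least 1/3, while the left
side never exceeds 4/9. Equality occurs when the other link alone is served at rate 1. -/
theorem sq_sub_le (h : DominatesAdHoc q s) (i : Fin 2) :
    (s i - 2 / 3) ^ 2 ≤ 4 / 3 * (4 / 3 - s 0 - s 1) := by
  obtain ⟨h, -⟩ := h
  fin_cases i <;> rcases h with h | h | h | h | h | h <;> norm_num [h.1, h.2]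

/-- The surplus weight of `(1, 0)` is exactly `(q 0 - 2 * q 1) / 3`, symmetrically for `(0, 1)`; the
other vectors have no surplus. -/
theorem weight_le (h : DominatesAdHoc q s) (hq : 0 ≤ q) :
    q 0 * s 0 + q 1 * s 1 - 2 / 3 * (q 0 + q 1) ≤
      1 / 3 * (max (q 0 - 2 * q 1) 0 + max (q 1 - 2 * q 0) 0) := by
  obtain ⟨h, -⟩ := h
  have h0 : 0 ≤ q 0 := hq 0
  have h1 : 0 ≤ q 1 := hq 1
  have := le_max_left (q 0 - 2 * q 1) 0
  have := le_max_right (q 0 - 2 * q 1) 0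
  have := le_max_left (q 1 - 2 * q 0) 0
  have := le_max_right (q 1 - 2 * q 0) 0
  rcases h with h | h | h | h | h | h <;> rw [h.1, h.2] <;> linarith

/-- Outside the cone of the heavy-traffic normals, only the longer queue is served. -/
theorem eq_of_lt (h : DominatesAdHoc q s) (hq : 0 ≤ q) {i j : Fin 2} (hij : i ≠ j)
    (hlt : 2 * q j < q i) : s i = 1 ∧ s j = 0 := by
  obtain ⟨h, ha, hb, -⟩ := h
  have h0 : 0 ≤ q 0 := hq 0
  have h1 : 0 ≤ q 1 := hq 1
  fin_cases i <;> fin_cases j <;> simp at hij hlt ⊢ <;>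
  rcases h with h | h | h | h | h | h <;> rw [h.1, h.2] at ha hb <;>
    first | exact h | exact h.symm | (exfalso; linarith)

theorem abs_nextQueue_sub_le (h : DominatesAdHoc q s) (hq : 0 ≤ q) {a : Fin 2 → ℕ} {A : ℕ}
    (ha : ∀ i, a i ≤ A) (i : Fin 2) : |nextQueue q a s i - q i| ≤ A + 1 := by
  have h1 := h.nonneg i
  have h2 := h.le_one i
  have h3 : (a i : ℝ) ≤ A := by exact_mod_cast ha i
  have h4 : (0 : ℝ) ≤ a i := Nat.cast_nonneg _
  have h5 : 0 ≤ q i := hq i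
  rw [nextQueue_apply, abs_le]
  constructor
  · linarith [le_max_left (q i + a i - s i) 0]
  · rw [sub_le_iff_le_add]; exact max_le (by linarith) (by linarith)

/-- One-step change of the squared distance to the cone. -/
theorem sq_excess_le (h : DominatesAdHoc q s) (hq : 0 ≤ q) {a : Fin 2 → ℕ} {A : ℕ}
    (ha : ∀ i, a i ≤ A) {i j : Fin 2} (hij : i ≠ j) :
    max (nextQueue q a s i - 2 * nextQueue q a s j) 0 ^ 2 - max (q i - 2 * q j) 0 ^ 2 ≤
      2 * (max (q i - 2 * q j) 0 * ((a i : ℝ) - 2 * a j - 1)) + 2 * unusedService q a s i +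
      (3 * (A + 1)) ^ 2 * ((if 0 < q i - 2 * q j then 1 else 0) +
        (if 0 < nextQueue q a s i - 2 * nextQueue q a s j then 1 else 0)) := by
  have hi := abs_le.mp (h.abs_nextQueue_sub_le hq ha i)
  have hj := abs_le.mp (h.abs_nextQueue_sub_le hq ha j)
  have hu := unusedService_nonneg q a s i
  have hqi : 0 ≤ q i := hq i
  have hqj : 0 ≤ q j := hq j
  have hA : (0 : ℝ) ≤ A := Nat.cast_nonneg _
  set x := q i - 2 * q j with hx
  set x' := nextQueue q a s i - 2 * nextQueue q a s j with hx'
  have hB : (x' - x) ^ 2 ≤ (3 * ((A : ℝ) + 1)) ^ 2 :=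
    sq_le_sq' (by simp only [hx, hx']; linarith) (by simp only [hx, hx']; linarith)
  by_cases hpos : 0 < x
  · obtain ⟨hsi, hsj⟩ := h.eq_of_lt hq hij (by linarith)
    have haj : (0 : ℝ) ≤ a j := Nat.cast_nonneg _
    have hai : (0 : ℝ) ≤ a i := Nat.cast_nonneg _
    -- Queue `j` receives no service here, so it has no unused service.
    have hx1 : x' - x = (a i : ℝ) - 2 * a j - 1 + unusedService q a s i := by
      simp only [hx, hx']
      rw [nextQueue_apply q a s j, hsj, max_eq_left (by linarith), nextQueue_apply_eq_add, hsi]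
      ring
    -- Positive unused service forces `q i + a i < 1`, hence `x < 1`.
    have hxu : x * unusedService q a s i ≤ unusedService q a s i := by
      unfold unusedService
      rw [hsi]
      rcases le_total 1 (q i + a i) with h1 | h1
      · rw [min_eq_left h1]; simp
      · rw [min_eq_right h1]
        exact mul_le_of_le_one_left (by linarith) (by linarith)
    have hsq : max x' 0 ^ 2 ≤ x' ^ 2 := by
      rcases le_total x' 0 with h1 | h1
      · rw [max_eq_right h1, zero_pow two_ne_zero]; exact sq_nonneg _
      · rw [max_eq_left h1]
    have hind : (0 : ℝ) ≤ if 0 < x' then 1 else 0 := by split_ifs <;> norm_num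
    rw [max_eq_left hpos.le, if_pos hpos]
    have : (3 * ((A : ℝ) + 1)) ^ 2 * 1 ≤ (3 * ((A : ℝ) + 1)) ^ 2 *
        (1 + if 0 < x' then 1 else 0) := by gcongr; linarith
    have hexp : x' ^ 2 = x ^ 2 + 2 * x * (x' - x) + (x' - x) ^ 2 := by ring
    have hmul : 2 * x * (x' - x) =
        2 * (x * ((a i : ℝ) - 2 * a j - 1)) + 2 * (x * unusedService q a s i) := by
      rw [hx1]; ring
    linarith
  · rw [max_eq_right (not_lt.mp hpos), if_neg hpos]
    by_cases hpos' : 0 < x'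
    · rw [max_eq_left hpos'.le, if_pos hpos']
      -- Entering the region from `x ≤ 0`, the new excess is at most the size of the jump.
      have : x' ^ 2 ≤ (x' - x) ^ 2 := by
        have := not_lt.mp hpos
        gcongr; linarith
      linarith
    · rw [max_eq_right (not_lt.mp hpos'), if_neg hpos']
      linarith

end DominatesAdHoc

/-! ### Steady-state integrability and balance equations. -/

set_option linter.unusedSectionVars false

theorem measurable_natCast_apply {n : ℕ} (i : Fin n) :
    Measurable fun a : Fin n → ℕ => (a i : ℝ) :=
  (measurable_from_top (f := fun m : ℕ => (m : ℝ))).comp (measurable_pi_apply i)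

/-- `μ` is the joint law of queue lengths and services in steady state, with integrable queue
lengths, for arrivals with law `α` that are bounded by `A` and have load `1 - ε`. -/
structure IsStationaryPair (A : ℕ) (ε : ℝ) (α : Measure (Fin 2 → ℕ))
    (μ : Measure ((Fin 2 → ℝ) × (Fin 2 → ℝ))) : Prop where
  pos : 0 < ε
  lt_one : ε < 1
  dominates : ∀ᵐ p ∂μ, 0 ≤ p.1 ∧ DominatesAdHoc p.1 p.2
  bounded : ∀ᵐ a ∂α, ∀ i, a i ≤ A
  mean : ∀ i, ∫ a, (a i : ℝ) ∂α = (1 - ε) * (2 / 3)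
  stationary : (μ.prod α).map (fun ω => ω.1.1) =
    (μ.prod α).map (fun ω => nextQueue ω.1.1 ω.2 ω.1.2)
  integrable : ∀ i, Integrable (fun p => p.1 i) μ

namespace IsStationaryPair

variable {A : ℕ} {ε : ℝ} {α : Measure (Fin 2 → ℕ)} [IsProbabilityMeasure α]
  {μ : Measure ((Fin 2 → ℝ) × (Fin 2 → ℝ))} [IsProbabilityMeasure μ]

theorem ae_prod (h : IsStationaryPair A ε α μ) : ∀ᵐ ω ∂(μ.prod α),
    0 ≤ ω.1.1 ∧ DominatesAdHoc ω.1.1 ω.1.2 ∧ ∀ i, ω.2 i ≤ A := by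
  filter_upwards [Measure.quasiMeasurePreserving_fst.ae h.dominates,
    Measure.quasiMeasurePreserving_snd.ae h.bounded] with ω h1 h2
  exact ⟨h1.1, h1.2, h2⟩

theorem integrable_arrival (h : IsStationaryPair A ε α μ) (i : Fin 2) :
    Integrable (fun a : Fin 2 → ℕ => (a i : ℝ)) α := by
  refine Integrable.of_bound (measurable_natCast_apply i).aestronglyMeasurable A ?_
  filter_upwards [h.bounded] with a ha
  rw [Real.norm_of_nonneg (Nat.cast_nonneg _)]
  exact_mod_cast ha i

theorem integrable_service (h : IsStationaryPair A ε α μ) (i : Fin 2) :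
    Integrable (fun p => p.2 i) μ := by
  refine Integrable.of_bound (by fun_prop) 1 ?_
  filter_upwards [h.dominates] with p hp
  rw [Real.norm_of_nonneg (hp.2.nonneg i)]
  exact hp.2.le_one i

theorem integrable_queue_mul_service (h : IsStationaryPair A ε α μ) (i : Fin 2) :
    Integrable (fun p => p.1 i * p.2 i) μ := by
  refine (h.integrable i).mul_bdd (c := 1) (by fun_prop) ?_
  filter_upwards [h.dominates] with p hp
  rw [Real.norm_of_nonneg (hp.2.nonneg i)]
  exact hp.2.le_one i

theorem integrable_sq_service_sub (h : IsStationaryPair A ε α μ) (i : Fin 2) (m : ℝ) :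
    Integrable (fun p => (p.2 i - m) ^ 2) μ := by
  have h1 : Integrable (fun p => p.2 i * p.2 i) μ := by
    refine (h.integrable_service i).mul_bdd (c := 1) (by fun_prop) ?_
    filter_upwards [h.dominates] with p hp
    rw [Real.norm_of_nonneg (hp.2.nonneg i)]
    exact hp.2.le_one i
  have h2 := (h1.sub ((h.integrable_service i).const_mul (2 * m))).add (integrable_const (m ^ 2))
  refine h2.congr (Eventually.of_forall fun p => ?_)
  simp only [Pi.add_apply, Pi.sub_apply]
  ring

theorem integrable_unused (h : IsStationaryPair A ε α μ) (i : Fin 2) :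
    Integrable (fun ω => unusedService ω.1.1 ω.2 ω.1.2 i) (μ.prod α) := by
  refine Integrable.of_bound (measurable_unusedService i).aestronglyMeasurable 1 ?_
  filter_upwards [h.ae_prod] with ω hω
  rw [Real.norm_of_nonneg (unusedService_nonneg _ _ _ _)]
  exact (unusedService_le _ hω.1 i (hω.2.1.nonneg i)).trans (hω.2.1.le_one i)

theorem integrable_unused_sq (h : IsStationaryPair A ε α μ) (i : Fin 2) :
    Integrable (fun ω => unusedService ω.1.1 ω.2 ω.1.2 i ^ 2) (μ.prod α) := by
  refine Integrable.of_bound ((measurable_unusedService i).pow_const 2).aestronglyMeasurable 1 ?_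
  filter_upwards [h.ae_prod] with ω hω
  rw [Real.norm_of_nonneg (sq_nonneg _)]
  exact pow_le_one₀ (unusedService_nonneg _ _ _ _)
    ((unusedService_le _ hω.1 i (hω.2.1.nonneg i)).trans (hω.2.1.le_one i))

theorem integral_mul_arrival (h : IsStationaryPair A ε α μ)
    (f : (Fin 2 → ℝ) × (Fin 2 → ℝ) → ℝ) (i : Fin 2) :
    ∫ ω, f ω.1 * (ω.2 i : ℝ) ∂(μ.prod α) = (1 - ε) * (2 / 3) * ∫ p, f p ∂μ := by
  rw [integral_prod_mul f (fun a : Fin 2 → ℕ => (a i : ℝ)), h.mean, mul_comm]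

/-- For quadratic `V` the increments grow linearly, so first moments of the queues suffice. -/
theorem integral_increment_eq_zero (h : IsStationaryPair A ε α μ) {V : (Fin 2 → ℝ) → ℝ}
    (hV : Measurable V)
    (hint : Integrable (fun ω => V (nextQueue ω.1.1 ω.2 ω.1.2) - V ω.1.1) (μ.prod α)) :
    ∫ ω, (V (nextQueue ω.1.1 ω.2 ω.1.2) - V ω.1.1) ∂(μ.prod α) = 0 :=
  integral_sub_eq_zero_of_map_eq (measurable_fst.comp measurable_fst) measurable_nextQueue_assoc
    h.stationary hV hint

/-- Flow balance. -/
theorem integral_service_sub_unused (h : IsStationaryPair A ε α μ) (i : Fin 2) :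
    ∫ p, p.2 i ∂μ = (1 - ε) * (2 / 3) +
      ∫ ω, unusedService ω.1.1 ω.2 ω.1.2 i ∂(μ.prod α) := by
  have ha := (h.integrable_arrival i).comp_snd μ
  have hs := (h.integrable_service i).comp_fst α
  have hu := h.integrable_unused i
  have heq : (fun ω : ((Fin 2 → ℝ) × (Fin 2 → ℝ)) × (Fin 2 → ℕ) =>
      nextQueue ω.1.1 ω.2 ω.1.2 i - ω.1.1 i) =
      fun ω => (ω.2 i : ℝ) - ω.1.2 i + unusedService ω.1.1 ω.2 ω.1.2 i := by
    funext ω; rw [nextQueue_apply_eq_add]; ring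
  have h0 := h.integral_increment_eq_zero (V := fun q => q i) (by fun_prop)
    (heq ▸ (ha.sub hs).add hu)
  rw [heq] at h0
  replace h0 := (integral_add' (ha.sub hs) hu).symm.trans h0
  rw [integral_sub' ha hs,
    integral_fun_fst (fun p : (Fin 2 → ℝ) × (Fin 2 → ℝ) => p.2 i),
    integral_fun_snd (fun a : Fin 2 → ℕ => (a i : ℝ)), h.mean] at h0
  simp only [probReal_univ, one_smul] at h0
  linarith

/-- The balance equation of the square of a queue length. -/
theorem sq_balance (h : IsStationaryPair A ε α μ) (i : Fin 2) :
    2 * ((1 - ε) * (2 / 3)) * ∫ p, p.1 i ∂μ - 2 * ∫ p, p.1 i * p.2 i ∂μ +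
      variance (fun a : Fin 2 → ℕ => (a i : ℝ)) α +
      ∫ p, (p.2 i - (1 - ε) * (2 / 3)) ^ 2 ∂μ -
      ∫ ω, unusedService ω.1.1 ω.2 ω.1.2 i ^ 2 ∂(μ.prod α) = 0 := by
  set m : ℝ := (1 - ε) * (2 / 3) with hm
  have ha := h.integrable_arrival i
  have ham : Integrable (fun a : Fin 2 → ℕ => (a i : ℝ) - m) α := ha.sub (integrable_const m)
  have hv : Integrable (fun a : Fin 2 → ℕ => ((a i : ℝ) - m) ^ 2) α := by
    refine Integrable.of_bound
      (((measurable_natCast_apply i).sub measurable_const).pow_const 2).aestronglyMeasurable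
      ((A + |m|) ^ 2) ?_
    filter_upwards [h.bounded] with a ha
    rw [norm_pow]
    gcongr
    refine (norm_sub_le _ _).trans ?_
    rw [Real.norm_of_nonneg (Nat.cast_nonneg _), Real.norm_eq_abs]
    gcongr
    exact ha i
  have hmean0 : ∫ a, ((a i : ℝ) - m) ∂α = 0 := by
    rw [integral_sub ha (integrable_const m), h.mean]; simp [hm]
  have hvar : variance (fun a : Fin 2 → ℕ => (a i : ℝ)) α = ∫ a, ((a i : ℝ) - m) ^ 2 ∂α := by
    rw [variance_eq_integral (measurable_natCast_apply i).aemeasurable, h.mean]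
  have hqs := (h.integrable_queue_mul_service i).comp_fst α
  have hqa := (h.integrable i).mul_prod ha
  have hss := (h.integrable_sq_service_sub i m).comp_fst α
  have hsm : Integrable (fun p : (Fin 2 → ℝ) × (Fin 2 → ℝ) => p.2 i - m) μ :=
    (h.integrable_service i).sub (integrable_const m)
  -- With the arrivals centred, independence kills this cross term.
  have hcr := hsm.mul_prod ham
  have hvv := hv.comp_snd μ
  have hu := h.integrable_unused_sq i
  have heq : (fun ω : ((Fin 2 → ℝ) × (Fin 2 → ℝ)) × (Fin 2 → ℕ) =>
      nextQueue ω.1.1 ω.2 ω.1.2 i ^ 2 - ω.1.1 i ^ 2) =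
      fun ω => 2 * (ω.1.1 i * (ω.2 i : ℝ)) - 2 * (ω.1.1 i * ω.1.2 i) + ((ω.2 i : ℝ) - m) ^ 2 -
        2 * ((ω.1.2 i - m) * ((ω.2 i : ℝ) - m)) + (ω.1.2 i - m) ^ 2 -
        unusedService ω.1.1 ω.2 ω.1.2 i ^ 2 := by
    funext ω
    have h1 := nextQueue_mul_unusedService ω.1.1 ω.2 ω.1.2 i
    have h2 := nextQueue_apply_eq_add ω.1.1 ω.2 ω.1.2 i
    -- Complementarity removes the product of queue length and unused service, leaving only the
    -- square of the latter.
    have h3 : nextQueue ω.1.1 ω.2 ω.1.2 i ^ 2 =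
        (nextQueue ω.1.1 ω.2 ω.1.2 i - unusedService ω.1.1 ω.2 ω.1.2 i) ^ 2 -
        unusedService ω.1.1 ω.2 ω.1.2 i ^ 2 := by linear_combination 2 * h1
    rw [h3, h2]
    ring
  have i1 := (hqa.const_mul 2).sub (hqs.const_mul 2)
  have i2 := i1.add hvv
  have i3 := i2.sub (hcr.const_mul 2)
  have i4 := i3.add hss
  have h0 := h.integral_increment_eq_zero (V := fun q => q i ^ 2) (by fun_prop)
    (heq ▸ i4.sub hu)
  rw [heq] at h0
  replace h0 := (integral_sub' i4 hu).symm.trans h0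
  rw [integral_add' i3 hss, integral_sub' i2 (hcr.const_mul 2),
    integral_add' i1 hvv, integral_sub' (hqa.const_mul 2) (hqs.const_mul 2),
    integral_const_mul, integral_const_mul, integral_const_mul,
    h.integral_mul_arrival (fun p => p.1 i),
    integral_prod_mul (fun p : (Fin 2 → ℝ) × (Fin 2 → ℝ) => p.2 i - m)
      (fun a : Fin 2 → ℕ => (a i : ℝ) - m), hmean0,
    integral_fun_fst (fun p : (Fin 2 → ℝ) × (Fin 2 → ℝ) => p.1 i * p.2 i),
    integral_fun_fst (fun p : (Fin 2 → ℝ) × (Fin 2 → ℝ) => (p.2 i - m) ^ 2),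
    integral_fun_snd (fun a : Fin 2 → ℕ => ((a i : ℝ) - m) ^ 2), ← hvar] at h0
  simp only [probReal_univ, one_smul] at h0
  rw [← hm] at h0
  linarith

/-! ### Quantities of order `ε` and state space collapse. -/

/-- Total service deficit and total unused service. -/
theorem deficit_add_unused (h : IsStationaryPair A ε α μ) :
    ∫ p, (4 / 3 - p.2 0 - p.2 1) ∂μ + (∫ ω, unusedService ω.1.1 ω.2 ω.1.2 0 ∂(μ.prod α) +
      ∫ ω, unusedService ω.1.1 ω.2 ω.1.2 1 ∂(μ.prod α)) = 4 / 3 * ε := by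
  have h0 := h.integral_service_sub_unused 0
  have h1 := h.integral_service_sub_unused 1
  have i0 : Integrable (fun p : (Fin 2 → ℝ) × (Fin 2 → ℝ) => 4 / 3 - p.2 0) μ :=
    (integrable_const _).sub (h.integrable_service 0)
  rw [integral_sub i0 (h.integrable_service 1),
    integral_sub (integrable_const _) (h.integrable_service 0)]
  simp only [integral_const, probReal_univ, one_smul]
  linarith

theorem integrable_deficit (h : IsStationaryPair A ε α μ) :
    Integrable (fun p : (Fin 2 → ℝ) × (Fin 2 → ℝ) => 4 / 3 - p.2 0 - p.2 1) μ :=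
  ((integrable_const _).sub (h.integrable_service 0)).sub (h.integrable_service 1)

theorem integral_deficit_nonneg (h : IsStationaryPair A ε α μ) :
    0 ≤ ∫ p, (4 / 3 - p.2 0 - p.2 1) ∂μ := by
  refine integral_nonneg_of_ae ?_
  filter_upwards [h.dominates] with p hp
  have := hp.2.sum_le
  simp only [Pi.zero_apply]
  linarith

theorem integral_unused_nonneg (i : Fin 2) :
    0 ≤ ∫ ω, unusedService ω.1.1 ω.2 ω.1.2 i ∂(μ.prod α) :=
  integral_nonneg fun _ => unusedService_nonneg _ _ _ _

theorem integral_unused_le (h : IsStationaryPair A ε α μ) (i : Fin 2) :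
    ∫ ω, unusedService ω.1.1 ω.2 ω.1.2 i ∂(μ.prod α) ≤ 4 / 3 * ε := by
  have h0 := h.deficit_add_unused
  have h1 := h.integral_deficit_nonneg
  have h2 := integral_unused_nonneg (α := α) (μ := μ) 0
  have h3 := integral_unused_nonneg (α := α) (μ := μ) 1
  fin_cases i <;> simp only [Fin.zero_eta, Fin.mk_one] <;> linarith

theorem integral_deficit_le (h : IsStationaryPair A ε α μ) :
    ∫ p, (4 / 3 - p.2 0 - p.2 1) ∂μ ≤ 4 / 3 * ε := by
  linarith [h.deficit_add_unused, integral_unused_nonneg (α := α) (μ := μ) 0,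
    integral_unused_nonneg (α := α) (μ := μ) 1]

theorem integral_unused_sq_le (h : IsStationaryPair A ε α μ) (i : Fin 2) :
    ∫ ω, unusedService ω.1.1 ω.2 ω.1.2 i ^ 2 ∂(μ.prod α) ≤ 4 / 3 * ε := by
  refine (integral_mono_ae (h.integrable_unused_sq i) (h.integrable_unused i) ?_).trans
    (h.integral_unused_le i)
  filter_upwards [h.ae_prod] with ω hω
  have h0 := unusedService_nonneg ω.1.1 ω.2 ω.1.2 i
  have h1 := (unusedService_le ω.2 hω.1 i (hω.2.1.nonneg i)).trans (hω.2.1.le_one i)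
  rw [pow_two]
  exact mul_le_of_le_one_left h0 h1

theorem integral_sq_service_sub_le (h : IsStationaryPair A ε α μ) (i : Fin 2) :
    ∫ p, (p.2 i - (1 - ε) * (2 / 3)) ^ 2 ∂μ ≤ 5 * ε := by
  have hb : ∫ p, (p.2 i - (1 - ε) * (2 / 3)) ^ 2 ∂μ ≤
      ∫ p, (8 / 3 * (4 / 3 - p.2 0 - p.2 1) + 8 / 9 * ε) ∂μ := by
    refine integral_mono_ae (h.integrable_sq_service_sub i _)
      ((h.integrable_deficit.const_mul _).add (integrable_const _)) ?_
    filter_upwards [h.dominates] with p hp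
    have h1 := hp.2.sq_sub_le i
    -- This is `(x + y) ^ 2 ≤ 2 * x ^ 2 + 2 * y ^ 2` with `x = p.2 i - 2/3` and `y = 2/3 * ε`.
    have h2 := sq_nonneg (p.2 i - 2 / 3 - 2 / 3 * ε)
    have h3 : ε * ε ≤ ε := mul_le_of_le_one_left h.pos.le h.lt_one.le
    linarith
  rw [integral_add (h.integrable_deficit.const_mul _) (integrable_const _), integral_const_mul,
    integral_const, probReal_univ, one_smul] at hb
  have h1 := h.integral_deficit_le
  have h2 := h.pos
  linarith

theorem integrable_excess (h : IsStationaryPair A ε α μ) (i j : Fin 2) :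
    Integrable (fun p : (Fin 2 → ℝ) × (Fin 2 → ℝ) => max (p.1 i - 2 * p.1 j) 0) μ :=
  ((h.integrable i).sub ((h.integrable j).const_mul 2)).pos_part

/-- The probability of being outside the cone. -/
theorem integral_indicator_excess_le (h : IsStationaryPair A ε α μ) {i j : Fin 2} (hij : i ≠ j) :
    ∫ p, (if 0 < p.1 i - 2 * p.1 j then 1 else 0 : ℝ) ∂μ ≤ 4 * ε := by
  have hb : ∫ p, (if 0 < p.1 i - 2 * p.1 j then 1 else 0 : ℝ) ∂μ ≤
      ∫ p, 3 * (4 / 3 - p.2 0 - p.2 1) ∂μ := by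
    refine integral_mono_of_nonneg
      (Eventually.of_forall fun p => by dsimp only [Pi.zero_apply]; split_ifs <;> norm_num)
      (h.integrable_deficit.const_mul 3) ?_
    filter_upwards [h.dominates] with p hp
    have h1 := hp.2.sum_le
    split_ifs with hlt
    -- Outside the cone the deficit is `4/3 - 1 = 1/3`, whence the factor 3.
    · obtain ⟨ha, hb⟩ := hp.2.eq_of_lt hp.1 hij (by linarith)
      have : p.2 0 + p.2 1 = 1 := by
        fin_cases i <;> fin_cases j <;> simp at hij ha hb <;> rw [ha, hb] <;> norm_num
      linarith
    · linarith
  rw [integral_const_mul] at hb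
  linarith [h.integral_deficit_le]

/-- State space collapse: the mean distance to the cone is of order `ε`. -/
theorem integral_excess_le (h : IsStationaryPair A ε α μ) {i j : Fin 2} (hij : i ≠ j) :
    ∫ p, max (p.1 i - 2 * p.1 j) 0 ∂μ ≤ (4 / 3 + 4 * (3 * ((A : ℝ) + 1)) ^ 2) * ε := by
  set B : ℝ := 3 * ((A : ℝ) + 1) with hB
  have hB0 : 0 ≤ B := by positivity
  let v : (Fin 2 → ℝ) → ℝ := fun q => max (q i - 2 * q j) 0
  let I : (Fin 2 → ℝ) → ℝ := fun q => if 0 < q i - 2 * q j then 1 else 0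
  have hvm : Measurable v := by fun_prop
  have hIm : Measurable I :=
    Measurable.ite (measurableSet_lt measurable_const (by fun_prop)) measurable_const
      measurable_const
  have hIb (q) : ‖I q‖ ≤ 1 := by simp only [I]; split_ifs <;> norm_num
  have hI0 : Integrable (fun ω : ((Fin 2 → ℝ) × (Fin 2 → ℝ)) × (Fin 2 → ℕ) => I ω.1.1)
      (μ.prod α) :=
    Integrable.of_bound (hIm.comp (measurable_fst.comp measurable_fst)).aestronglyMeasurable 1
      (Eventually.of_forall fun _ => hIb _)
  have hI1 : Integrable (fun ω : ((Fin 2 → ℝ) × (Fin 2 → ℝ)) × (Fin 2 → ℕ) =>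
      I (nextQueue ω.1.1 ω.2 ω.1.2)) (μ.prod α) :=
    Integrable.of_bound (hIm.comp measurable_nextQueue_assoc).aestronglyMeasurable 1
      (Eventually.of_forall fun _ => hIb _)
  have hv : Integrable (fun p : (Fin 2 → ℝ) × (Fin 2 → ℝ) => v p.1) μ := h.integrable_excess i j
  have hvP : Integrable (fun ω : ((Fin 2 → ℝ) × (Fin 2 → ℝ)) × (Fin 2 → ℕ) => v ω.1.1)
      (μ.prod α) := hv.comp_fst α
  have hinc : Integrable (fun ω : ((Fin 2 → ℝ) × (Fin 2 → ℝ)) × (Fin 2 → ℕ) =>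
      v (nextQueue ω.1.1 ω.2 ω.1.2) ^ 2 - v ω.1.1 ^ 2) (μ.prod α) := by
    refine Integrable.mono' ((hvP.const_mul (2 * B)).add (integrable_const (B ^ 2)))
      (((hvm.comp measurable_nextQueue_assoc).pow_const 2).sub
        ((hvm.comp (measurable_fst.comp measurable_fst)).pow_const 2)).aestronglyMeasurable ?_
    filter_upwards [h.ae_prod] with ω hω
    have h1 := abs_le.mp (hω.2.1.abs_nextQueue_sub_le hω.1 hω.2.2 i)
    have h2 := abs_le.mp (hω.2.1.abs_nextQueue_sub_le hω.1 hω.2.2 j)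
    have h3 : |v (nextQueue ω.1.1 ω.2 ω.1.2) - v ω.1.1| ≤ B := by
      refine (abs_max_sub_max_le_max _ _ _ _).trans (max_le ?_ (by simpa using hB0))
      rw [abs_le, hB]
      constructor <;> linarith
    have h4 : 0 ≤ v ω.1.1 := le_max_right _ _
    have h5 : v (nextQueue ω.1.1 ω.2 ω.1.2) ^ 2 - v ω.1.1 ^ 2 =
        2 * ((v (nextQueue ω.1.1 ω.2 ω.1.2) - v ω.1.1) * v ω.1.1) +
          (v (nextQueue ω.1.1 ω.2 ω.1.2) - v ω.1.1) ^ 2 := by ring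
    rw [Real.norm_eq_abs, h5]
    refine (abs_add_le _ _).trans ?_
    simp only [Pi.add_apply, mul_assoc]
    gcongr
    · rw [abs_mul, abs_mul, abs_of_nonneg h4, abs_two]
      gcongr
    · rw [abs_pow]
      gcongr
  have hzero := h.integral_increment_eq_zero (V := fun q => v q ^ 2) (hvm.pow_const 2) hinc
  -- By stationarity, being outside the cone after the step is as unlikely as before it.
  have hIeq : ∫ ω, (I (nextQueue ω.1.1 ω.2 ω.1.2) - I ω.1.1) ∂(μ.prod α) = 0 :=
    h.integral_increment_eq_zero hIm (hI1.sub hI0)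
  rw [integral_sub hI1 hI0] at hIeq
  have hai := hv.mul_prod (h.integrable_arrival i)
  have haj := hv.mul_prod (h.integrable_arrival j)
  have hu := h.integrable_unused i
  have j1 := ((hai.const_mul 2).sub (haj.const_mul 4)).sub (hvP.const_mul 2)
  have j2 := j1.add (hu.const_mul 2)
  have j3 := j2.add ((hI0.add hI1).const_mul (B ^ 2))
  have hle := integral_mono_ae hinc j3 (by
    filter_upwards [h.ae_prod] with ω hω
    have := hω.2.1.sq_excess_le hω.1 hω.2.2 hij
    simp only [Pi.add_apply, Pi.sub_apply, v, I]
    linarith)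
  have hsplit := integral_add' j2 ((hI0.add hI1).const_mul (B ^ 2))
  have hsplit2 := integral_add' j1 (hu.const_mul 2)
  have hsplit3 := integral_sub' ((hai.const_mul 2).sub (haj.const_mul 4)) (hvP.const_mul 2)
  have hsplit4 := integral_sub' (hai.const_mul 2) (haj.const_mul 4)
  have hsplit5 := integral_add' hI0 hI1
  simp only [integral_const_mul] at hsplit hsplit2 hsplit3 hsplit4
  have e1 := h.integral_mul_arrival (fun p => v p.1) i
  have e2 := h.integral_mul_arrival (fun p => v p.1) j
  have e3 : ∫ ω, v ω.1.1 ∂(μ.prod α) = ∫ p, v p.1 ∂μ := by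
    rw [integral_fun_fst (fun p : (Fin 2 → ℝ) × (Fin 2 → ℝ) => v p.1)]; simp
  have e4 : ∫ ω, I ω.1.1 ∂(μ.prod α) = ∫ p, I p.1 ∂μ := by
    rw [integral_fun_fst (fun p : (Fin 2 → ℝ) × (Fin 2 → ℝ) => I p.1)]; simp
  have e5 : ∫ p, I p.1 ∂μ ≤ 4 * ε := h.integral_indicator_excess_le hij
  have e6 := h.integral_unused_le i
  have e7 : 0 ≤ ∫ p, v p.1 ∂μ := integral_nonneg fun p => le_max_right _ _
  -- The mean of `a i - 2 * a j - 1` is `-(1 - ε) * (2/3) - 1 ≤ -1`: the drift stays away from zero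
  -- uniformly in `ε`.
  have e8 : 0 ≤ (1 - ε) * ∫ p, v p.1 ∂μ := mul_nonneg (by linarith [h.lt_one]) e7
  have e9 : B ^ 2 * ∫ p, I p.1 ∂μ ≤ B ^ 2 * (4 * ε) := by gcongr
  change ∫ p, v p.1 ∂μ ≤ _
  rw [hzero, hsplit, hsplit2, hsplit3, hsplit4, hsplit5, sub_eq_zero.mp hIeq, e1, e2, e3, e4]
    at hle
  linarith

/-- The scaled mean total queue length, up to an error of order `ε`. -/
theorem abs_sub_le (h : IsStationaryPair A ε α μ) :
    |ε * ∫ p, (p.1 0 + p.1 1) ∂μ - 3 / 4 * (variance (fun a : Fin 2 → ℕ => (a 0 : ℝ)) α +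
      variance (fun a : Fin 2 → ℕ => (a 1 : ℝ)) α)| ≤
      (12 + 4 * (3 * ((A : ℝ) + 1)) ^ 2) * ε := by
  set K : ℝ := 4 * (3 * ((A : ℝ) + 1)) ^ 2 with hK
  have hKε : 0 ≤ K * ε := mul_nonneg (by positivity) h.pos.le
  have hε := h.pos
  have b0 := h.sq_balance 0
  have b1 := h.sq_balance 1
  have s0 := h.integral_sq_service_sub_le 0
  have s1 := h.integral_sq_service_sub_le 1
  have t0 : 0 ≤ ∫ p, (p.2 0 - (1 - ε) * (2 / 3)) ^ 2 ∂μ := integral_nonneg fun _ => sq_nonneg _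
  have t1 : 0 ≤ ∫ p, (p.2 1 - (1 - ε) * (2 / 3)) ^ 2 ∂μ := integral_nonneg fun _ => sq_nonneg _
  have u0 := h.integral_unused_sq_le 0
  have u1 := h.integral_unused_sq_le 1
  have v0 : 0 ≤ ∫ ω, unusedService ω.1.1 ω.2 ω.1.2 0 ^ 2 ∂(μ.prod α) :=
    integral_nonneg fun _ => sq_nonneg _
  have v1 : 0 ≤ ∫ ω, unusedService ω.1.1 ω.2 ω.1.2 1 ^ 2 ∂(μ.prod α) :=
    integral_nonneg fun _ => sq_nonneg _
  have x0 := h.integral_excess_le (i := 0) (j := 1) (by simp)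
  have x1 := h.integral_excess_le (i := 1) (j := 0) (by simp)
  have hw := ((h.integrable_queue_mul_service 0).add (h.integrable_queue_mul_service 1)).sub
    (((h.integrable 0).add (h.integrable 1)).const_mul (2 / 3))
  -- The mean surplus weight is squeezed between 0 and a third of the mean excesses.
  have hw1 := integral_nonneg_of_ae (μ := μ) (f := fun p =>
      p.1 0 * p.2 0 + p.1 1 * p.2 1 - 2 / 3 * (p.1 0 + p.1 1)) (by
    filter_upwards [h.dominates] with p hp
    exact sub_nonneg.mpr hp.2.2.2.2)
  have hw2 := integral_mono_ae hw
    (((h.integrable_excess 0 1).add (h.integrable_excess 1 0)).const_mul (1 / 3)) (by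
    filter_upwards [h.dominates] with p hp
    exact hp.2.weight_le hp.1)
  replace hw1 := hw1.trans_eq (integral_sub' ((h.integrable_queue_mul_service 0).add
    (h.integrable_queue_mul_service 1)) (((h.integrable 0).add (h.integrable 1)).const_mul (2 / 3)))
  rw [integral_sub' ((h.integrable_queue_mul_service 0).add (h.integrable_queue_mul_service 1))
    (((h.integrable 0).add (h.integrable 1)).const_mul (2 / 3)), integral_const_mul,
    integral_const_mul, integral_add' (h.integrable_queue_mul_service 0)
    (h.integrable_queue_mul_service 1), integral_add' (h.integrable 0) (h.integrable 1),
    integral_add' (h.integrable_excess 0 1) (h.integrable_excess 1 0)] at hw2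
  rw [integral_const_mul, integral_add (h.integrable_queue_mul_service 0)
    (h.integrable_queue_mul_service 1), integral_add (h.integrable 0) (h.integrable 1)] at hw1
  rw [integral_add (h.integrable 0) (h.integrable 1), abs_le]
  constructor <;> linarith

end IsStationaryPair

/-! ### Existence of steady states and finiteness of their means. -/

theorem isMarkovKernel_queueKernel {n : ℕ} (α : Measure (Fin n → ℕ)) [IsProbabilityMeasure α]
    (τ : Kernel (Fin n → ℝ) (Fin n → ℝ)) [IsMarkovKernel τ] : IsMarkovKernel (queueKernel α τ) := by
  unfold queueKernel
  exact Kernel.IsMarkovKernel.map _ measurable_nextQueue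

/-- In steady state, the queue lengths in the next time slot have the stationary law. -/
theorem map_nextQueue_of_invariant {n : ℕ} {α : Measure (Fin n → ℕ)} [IsProbabilityMeasure α]
    {τ : Kernel (Fin n → ℝ) (Fin n → ℝ)} [IsMarkovKernel τ] {π : Measure (Fin n → ℝ)}
    [IsProbabilityMeasure π] (hπ : (queueKernel α τ).Invariant π) :
    ((π ⊗ₘ τ).prod α).map (fun ω => nextQueue ω.1.1 ω.2 ω.1.2) = π := by
  refine Measure.ext_of_lintegral _ fun f hf => ?_
  have hfn : Measurable fun ω : ((Fin n → ℝ) × (Fin n → ℝ)) × (Fin n → ℕ) =>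
      f (nextQueue ω.1.1 ω.2 ω.1.2) := hf.comp measurable_nextQueue_assoc
  rw [lintegral_map hf measurable_nextQueue_assoc, lintegral_prod _ hfn.aemeasurable,
    Measure.lintegral_compProd hfn.lintegral_prod_right']
  conv_rhs => rw [← show π.bind (queueKernel α τ) = π from hπ,
    Measure.lintegral_bind (queueKernel α τ).measurable.aemeasurable hf.aemeasurable]
  refine lintegral_congr fun q => ?_
  have hq : Measurable fun p : (Fin n → ℝ) × (Fin n → ℕ) => nextQueue q p.2 p.1 :=
    measurable_nextQueue.comp measurable_prodMk_left
  have hfq : Measurable fun p : (Fin n → ℝ) × (Fin n → ℕ) => f (nextQueue q p.2 p.1) :=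
    hf.comp hq
  rw [queueKernel_apply, lintegral_map hf hq, lintegral_prod _ hfq.aemeasurable]

/-- The squared norm of the queue lengths satisfies a drift condition below capacity. -/
theorem lintegral_sq_queueKernel_add_le {S : Set (Fin 2 → ℝ)} (hS : adHocSchedules ⊆ S)
    (hS' : S ⊆ withProjections adHocSchedules) {α : Measure (Fin 2 → ℕ)} [IsProbabilityMeasure α]
    {A : ℕ} (hA : ∀ᵐ a ∂α, ∀ i, a i ≤ A) {ε : ℝ} (hε : 0 < ε)
    (hmean : ∀ i, ∫ a, (a i : ℝ) ∂α = (1 - ε) * (2 / 3))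
    {τ : Kernel (Fin 2 → ℝ) (Fin 2 → ℝ)} [IsMarkovKernel τ] (hτ : IsMaxWeight S τ)
    {q : Fin 2 → ℝ} (hq : 0 ≤ q) :
    ∫⁻ y, ENNReal.ofReal (y 0 ^ 2 + y 1 ^ 2) ∂(queueKernel α τ q) +
      ENNReal.ofReal (4 / 3 * ε * (q 0 + q 1)) ≤
    ENNReal.ofReal (q 0 ^ 2 + q 1 ^ 2) + ENNReal.ofReal (2 * ((A : ℝ) + 1) ^ 2) := by
  have hq0 : 0 ≤ q 0 := hq 0
  have hq1 : 0 ≤ q 1 := hq 1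
  have hm : Measurable fun p : (Fin 2 → ℝ) × (Fin 2 → ℕ) => nextQueue q p.2 p.1 :=
    measurable_nextQueue.comp measurable_prodMk_left
  rw [queueKernel_apply, lintegral_map (by fun_prop) hm]
  -- The service is eliminated through its weight, at least `2/3 * (q 0 + q 1)`; the bound then
  -- depends on the arrivals alone.
  let g : (Fin 2 → ℕ) → ℝ := fun a => q 0 ^ 2 + q 1 ^ 2 + 2 * ((A : ℝ) + 1) ^ 2 -
    4 / 3 * (q 0 + q 1) + 2 * q 0 * a 0 + 2 * q 1 * a 1
  have hg : ∀ᵐ p ∂((τ q).prod α),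
      nextQueue q p.2 p.1 0 ^ 2 + nextQueue q p.2 p.1 1 ^ 2 ≤ g p.2 := by
    filter_upwards [Measure.quasiMeasurePreserving_fst.ae (hτ q hq),
      Measure.quasiMeasurePreserving_snd.ae hA] with p hs ha
    have hd := dominatesAdHoc_of_mem hS hS' hs
    have hi (i : Fin 2) : nextQueue q p.2 p.1 i ^ 2 ≤
        q i ^ 2 + 2 * q i * (p.2 i - p.1 i) + ((A : ℝ) + 1) ^ 2 := by
      have h1 : nextQueue q p.2 p.1 i ^ 2 ≤ (q i + p.2 i - p.1 i) ^ 2 := by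
        rw [nextQueue_apply]
        rcases le_total (q i + p.2 i - p.1 i) 0 with h | h
        · rw [max_eq_right h, zero_pow two_ne_zero]; exact sq_nonneg _
        · rw [max_eq_left h]
      have h2 : ((p.2 i : ℝ) - p.1 i) ^ 2 ≤ ((A : ℝ) + 1) ^ 2 := by
        have h3 := hd.nonneg i
        have h4 := hd.le_one i
        have h5 : (p.2 i : ℝ) ≤ A := by exact_mod_cast ha i
        have h6 : (0 : ℝ) ≤ p.2 i := Nat.cast_nonneg _
        exact sq_le_sq' (by linarith) (by linarith)
      linarith
    have hw := hd.2.2.2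
    have h0 := hi 0
    have h1 := hi 1
    simp only [g]
    linarith
  have ha (i : Fin 2) : Integrable (fun a : Fin 2 → ℕ => (a i : ℝ)) α := by
    refine Integrable.of_bound (measurable_natCast_apply i).aestronglyMeasurable A ?_
    filter_upwards [hA] with a ha
    rw [Real.norm_of_nonneg (Nat.cast_nonneg _)]
    exact_mod_cast ha i
  have hgi0 : Integrable (fun a : Fin 2 → ℕ => q 0 ^ 2 + q 1 ^ 2 + 2 * ((A : ℝ) + 1) ^ 2 -
    4 / 3 * (q 0 + q 1) + 2 * q 0 * a 0) α := (integrable_const _).add ((ha 0).const_mul _)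
  have hgi : Integrable g α := hgi0.add ((ha 1).const_mul _)
  have hgint : ∫ p, g p.2 ∂((τ q).prod α) =
      q 0 ^ 2 + q 1 ^ 2 + 2 * ((A : ℝ) + 1) ^ 2 - 4 / 3 * ε * (q 0 + q 1) := by
    rw [integral_fun_snd g, probReal_univ, one_smul, integral_add hgi0 ((ha 1).const_mul _),
      integral_add (integrable_const _) ((ha 0).const_mul _), integral_const_mul,
      integral_const_mul, hmean, hmean, integral_const, probReal_univ, one_smul]
    ring
  have hle : ∫⁻ p, ENNReal.ofReal (nextQueue q p.2 p.1 0 ^ 2 + nextQueue q p.2 p.1 1 ^ 2)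
      ∂((τ q).prod α) ≤
      ENNReal.ofReal (q 0 ^ 2 + q 1 ^ 2 + 2 * ((A : ℝ) + 1) ^ 2 - 4 / 3 * ε * (q 0 + q 1)) := by
    rw [← hgint, ofReal_integral_eq_lintegral_ofReal (hgi.comp_snd (τ q))
      (by filter_upwards [hg] with p hp using le_trans (by positivity) hp)]
    exact lintegral_mono_ae (hg.mono fun p hp => ENNReal.ofReal_le_ofReal hp)
  have hnn : 0 ≤ q 0 ^ 2 + q 1 ^ 2 + 2 * ((A : ℝ) + 1) ^ 2 - 4 / 3 * ε * (q 0 + q 1) := by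
    rw [← hgint]
    exact integral_nonneg_of_ae (by filter_upwards [hg] with p hp using le_trans (by positivity) hp)
  refine (add_le_add_left hle _).trans ?_
  rw [← ENNReal.ofReal_add hnn (by positivity), ← ENNReal.ofReal_add (by positivity) (by positivity)]
  exact ENNReal.ofReal_le_ofReal (by linarith)

/-- Existence of a steady state below capacity. -/
theorem exists_isSteadyState {S : Set (Fin 2 → ℝ)} (hS : adHocSchedules ⊆ S)
    (hS' : S ⊆ withProjections adHocSchedules) {α : Measure (Fin 2 → ℕ)} [IsProbabilityMeasure α]
    {A : ℕ} (hA : ∀ᵐ a ∂α, ∀ i, a i ≤ A) {ε : ℝ} (hε : 0 < ε)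
    (hmean : ∀ i, ∫ a, (a i : ℝ) ∂α = (1 - ε) * (2 / 3))
    {τ : Kernel (Fin 2 → ℝ) (Fin 2 → ℝ)} [IsMarkovKernel τ] (hτ : IsMaxWeight S τ) :
    ∃ π, IsSteadyState (queueKernel α τ) π := by
  have := isMarkovKernel_queueKernel α τ
  -- Services are multiples of 1/3 and arrivals are integers, so the queue lengths can be encoded by
  -- `ℕ`; `r` decodes.
  let e : (Fin 2 → ℕ) → (Fin 2 → ℝ) := fun x i => (x i : ℝ) / 3
  let r : (Fin 2 → ℝ) → (Fin 2 → ℕ) := fun y i => ⌊3 * y i⌋₊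
  have he : Measurable e := measurable_of_countable e
  have hr : Measurable r := measurable_pi_lambda _ fun i =>
    Nat.measurable_floor.comp ((measurable_pi_apply i).const_mul 3)
  have hre (x : Fin 2 → ℕ) : r (e x) = x := by
    funext i
    simp only [r, e]
    rw [mul_div_cancel₀ _ (three_ne_zero), Nat.floor_natCast]
  have he0 (x : Fin 2 → ℕ) : 0 ≤ e x := fun i => by simp only [e, Pi.zero_apply]; positivity
  let κ : Kernel (Fin 2 → ℕ) (Fin 2 → ℕ) := ((queueKernel α τ).comap e he).map r
  have : IsMarkovKernel κ := Kernel.IsMarkovKernel.map _ hr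
  -- the chain does not leave the lattice
  have hlattice (x : Fin 2 → ℕ) : ∀ᵐ y ∂(queueKernel α τ (e x)), e (r y) = y := by
    have hm : Measurable fun p : (Fin 2 → ℝ) × (Fin 2 → ℕ) => nextQueue (e x) p.2 p.1 :=
      measurable_nextQueue.comp measurable_prodMk_left
    have hset : MeasurableSet {y | e (r y) = y} :=
      measurableSet_eq_fun (he.comp hr) measurable_id
    rw [queueKernel_apply, ae_map_iff hm.aemeasurable hset]
    filter_upwards [Measure.quasiMeasurePreserving_fst.ae (hτ (e x) (he0 x))] with p hs
    have hd := (dominatesAdHoc_of_mem hS hS' hs).1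
    have hc (i : Fin 2) : ∃ c : ℕ, p.1 i = c / 3 := by
      have : p.1 i = (0 : ℕ) / 3 ∨ p.1 i = (2 : ℕ) / 3 ∨ p.1 i = (3 : ℕ) / 3 := by
        fin_cases i <;> rcases hd with h | h | h | h | h | h <;> norm_num [h.1, h.2]
      rcases this with h | h | h <;> exact ⟨_, h⟩
    choose c hc using hc
    have : nextQueue (e x) p.2 p.1 = e fun i => x i + 3 * p.2 i - c i := by
      funext i
      rw [nextQueue_apply, hc]
      simp only [e]
      rcases le_total (c i) (x i + 3 * p.2 i) with h | h
      · have h' : (c i : ℝ) ≤ x i + 3 * p.2 i := by exact_mod_cast h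
        rw [max_eq_left (by linarith)]
        push_cast [h]
        ring
      · have h' : (x i : ℝ) + 3 * p.2 i ≤ c i := by exact_mod_cast h
        rw [max_eq_right (by linarith), Nat.sub_eq_zero_of_le h]
        simp
    rw [this, hre]
  have hmap (x : Fin 2 → ℕ) : (κ x).map e = queueKernel α τ (e x) := by
    rw [Kernel.map_apply _ hr, Kernel.comap_apply, Measure.map_map he hr]
    conv_rhs => rw [← Measure.map_id (μ := queueKernel α τ (e x))]
    exact Measure.map_congr (hlattice x)
  have hVm : Measurable fun q : Fin 2 → ℝ => ENNReal.ofReal (q 0 ^ 2 + q 1 ^ 2) := by fun_prop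
  obtain ⟨π, hπ, hinv⟩ := exists_invariant_of_drift κ 0
    (V := fun x => ENNReal.ofReal (e x 0 ^ 2 + e x 1 ^ 2))
    (f := fun x => ENNReal.ofReal (4 / 3 * ε * (e x 0 + e x 1)))
    (b := ENNReal.ofReal (2 * ((A : ℝ) + 1) ^ 2)) ENNReal.ofReal_ne_top ENNReal.ofReal_ne_top
    (fun x => by
      have h1 := lintegral_sq_queueKernel_add_le hS hS' hA hε hmean hτ (he0 x)
      rwa [← hmap, lintegral_map hVm he] at h1)
    (fun R => by
      -- In lattice units the drift is `4/9 * ε * (x 0 + x 1)`, so this bounds the sublevel set.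
      obtain ⟨N, hN⟩ := exists_nat_ge (R * 9 / (4 * ε))
      refine (finite_Icc (0 : Fin 2 → ℕ) fun _ => N).subset fun x hx => ⟨zero_le, fun i => ?_⟩
      have hx' : ENNReal.ofReal (4 / 3 * ε * (e x 0 + e x 1)) ≤ R := hx
      rw [ENNReal.ofReal_le_natCast] at hx'
      rw [div_le_iff₀ (by positivity)] at hN
      have h0 : (0 : ℝ) ≤ x 0 := Nat.cast_nonneg _
      have h1 : (0 : ℝ) ≤ x 1 := Nat.cast_nonneg _
      have hle : ((x 0 : ℝ) + x 1) * (4 * ε) ≤ N * (4 * ε) := by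
        refine le_trans ?_ hN
        simp only [e] at hx'
        linarith
      have hle' := le_of_mul_le_mul_right hle (by positivity)
      have : (x i : ℝ) ≤ N := by
        fin_cases i <;> simp only [Fin.zero_eta, Fin.mk_one] <;> linarith
      exact_mod_cast this)
  refine ⟨π.map e, Measure.isProbabilityMeasure_map he.aemeasurable, ?_⟩
  refine Measure.ext_of_lintegral _ fun f hf => ?_
  rw [Measure.lintegral_bind (queueKernel α τ).measurable.aemeasurable hf.aemeasurable,
    lintegral_map hf.lintegral_kernel he, lintegral_map hf he]
  have hfe : Measurable fun x => f (e x) := hf.comp he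
  conv_rhs => rw [← show π.bind κ = π from hinv,
    Measure.lintegral_bind κ.measurable.aemeasurable hfe.aemeasurable]
  refine lintegral_congr fun x => ?_
  rw [← hmap, lintegral_map hf he]

/-- The joint law of queue lengths and services in any steady state below capacity. -/
theorem IsSteadyState.isStationaryPair {S : Set (Fin 2 → ℝ)} (hS : adHocSchedules ⊆ S)
    (hS' : S ⊆ withProjections adHocSchedules) {α : Measure (Fin 2 → ℕ)} [IsProbabilityMeasure α]
    {A : ℕ} (hA : ∀ᵐ a ∂α, ∀ i, a i ≤ A) {ε : ℝ} (hε : ε ∈ Ioo (0 : ℝ) 1)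
    (hmean : ∀ i, ∫ a, (a i : ℝ) ∂α = (1 - ε) * (2 / 3))
    {τ : Kernel (Fin 2 → ℝ) (Fin 2 → ℝ)} [IsMarkovKernel τ] (hτ : IsMaxWeight S τ)
    {π : Measure (Fin 2 → ℝ)} (hπ : IsSteadyState (queueKernel α τ) π) :
    IsStationaryPair A ε α (π ⊗ₘ τ) := by
  obtain ⟨hprob, hinv⟩ := hπ
  have := isMarkovKernel_queueKernel α τ
  have hnext := map_nextQueue_of_invariant hinv
  have hfst : (π ⊗ₘ τ).map Prod.fst = π := Measure.fst_compProd π τ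
  -- An arbitrary stationary law lives on the orthant because one step always lands there.
  have hpos : ∀ᵐ q ∂π, 0 ≤ q := by
    have hset : MeasurableSet {q : Fin 2 → ℝ | 0 ≤ q} :=
      measurableSet_le measurable_const measurable_id
    rw [← hnext, ae_map_iff measurable_nextQueue_assoc.aemeasurable hset]
    exact Eventually.of_forall fun ω => nextQueue_nonneg _ _ _
  have hdrift := lintegral_le_of_drift hinv
    (V := fun q => ENNReal.ofReal (q 0 ^ 2 + q 1 ^ 2))
    (f := fun q => ENNReal.ofReal (4 / 3 * ε * (q 0 + q 1)))
    (by fun_prop) (by fun_prop) (fun _ => ENNReal.ofReal_ne_top)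
    (hpos.mono fun q hq => lintegral_sq_queueKernel_add_le hS hS' hA hε.1 hmean hτ hq)
  have hsum : Integrable (fun q : Fin 2 → ℝ => 4 / 3 * ε * (q 0 + q 1)) π := by
    refine ⟨by fun_prop, (hasFiniteIntegral_iff_ofReal ?_).mpr
      (hdrift.trans_lt ENNReal.ofReal_lt_top)⟩
    filter_upwards [hpos] with q hq
    exact mul_nonneg (by linarith [hε.1]) (add_nonneg (hq 0) (hq 1))
  have hqi (i : Fin 2) : Integrable (fun q : Fin 2 → ℝ => q i) π := by
    have hsum' : Integrable (fun q : Fin 2 → ℝ => q 0 + q 1) π :=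
      (integrable_const_mul_iff (isUnit_iff_ne_zero.mpr (by
        have := hε.1
        positivity)) _).mp hsum
    refine hsum'.mono' (measurable_pi_apply i).aestronglyMeasurable ?_
    filter_upwards [hpos] with q hq
    have h0 : 0 ≤ q 0 := hq 0
    have h1 : 0 ≤ q 1 := hq 1
    rw [Real.norm_of_nonneg (hq i)]
    fin_cases i <;> simp only [Fin.zero_eta, Fin.mk_one] <;> linarith
  exact
    { pos := hε.1
      lt_one := hε.2
      dominates := by
        refine Measure.ae_compProd_of_ae_ae measurableSet_dominatesAdHoc ?_
        filter_upwards [hpos] with q hq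
        filter_upwards [hτ q hq] with s hs
        exact ⟨hq, dominatesAdHoc_of_mem hS hS' hs⟩
      bounded := hA
      mean := hmean
      stationary := by
        have h1 := Measure.map_map (μ := (π ⊗ₘ τ).prod α) (g := Prod.fst) (f := Prod.fst)
          measurable_fst measurable_fst
        rw [Measure.map_fst_prod, measure_univ, one_smul, hfst] at h1
        exact h1.symm.trans hnext.symm
      integrable := fun i => by
        have h1 := hqi i
        rw [← hfst] at h1
        exact h1.comp_measurable measurable_fst }

/-! ### The heavy-traffic limit. -/

theorem corollary6
    -- feasible service vectors: the three schedules, with or without their projections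
    (S : Set (Fin 2 → ℝ)) (hS : adHocSchedules ⊆ S) (hS' : S ⊆ withProjections adHocSchedules)
    -- `α ε` is the joint law of the numbers of arrivals in a time slot of the `ε`-th system
    (α : ℝ → Measure (Fin 2 → ℕ)) [∀ ε, IsProbabilityMeasure (α ε)]
    (Amax : ℕ) (hbdd : ∀ ε ∈ Ioo (0 : ℝ) 1, ∀ᵐ a ∂(α ε), ∀ i, a i ≤ Amax)
    (hmean : ∀ ε ∈ Ioo (0 : ℝ) 1, ∀ i, ∫ a, (a i : ℝ) ∂(α ε) = (1 - ε) * (2 / 3))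
    (σ : Fin 2 → ℝ)
    (hvar : ∀ i, Tendsto (fun ε : ℝ => variance (fun a : Fin 2 → ℕ => (a i : ℝ)) (α ε))
      (𝓝[>] 0) (𝓝 (σ i ^ 2)))
    -- `τ ε` is the MaxWeight scheduling rule of the `ε`-th system, with its tie-breaking
    (τ : ℝ → Kernel (Fin 2 → ℝ) (Fin 2 → ℝ)) [∀ ε, IsMarkovKernel (τ ε)]
    (hτ : ∀ ε ∈ Ioo (0 : ℝ) 1, IsMaxWeight S (τ ε)) :
    (∀ ε ∈ Ioo (0 : ℝ) 1, ∃ π : Measure (Fin 2 → ℝ),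
      IsSteadyState (queueKernel (α ε) (τ ε)) π) ∧
    ∀ π : ℝ → Measure (Fin 2 → ℝ),
      (∀ ε ∈ Ioo (0 : ℝ) 1, IsSteadyState (queueKernel (α ε) (τ ε)) (π ε)) →
      (∀ ε ∈ Ioo (0 : ℝ) 1, ∀ i, Integrable (fun q : Fin 2 → ℝ => q i) (π ε)) ∧
      Tendsto (fun ε : ℝ => ε * ∫ q, (q 0 + q 1) ∂(π ε)) (𝓝[>] 0)
        (𝓝 (3 / 4 * (σ 0 ^ 2 + σ 1 ^ 2))) := by
  have hpair : ∀ π : ℝ → Measure (Fin 2 → ℝ),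
      (∀ ε ∈ Ioo (0 : ℝ) 1, IsSteadyState (queueKernel (α ε) (τ ε)) (π ε)) →
      ∀ ε ∈ Ioo (0 : ℝ) 1, IsStationaryPair Amax ε (α ε) (π ε ⊗ₘ τ ε) := fun π hπ ε hε =>
    (hπ ε hε).isStationaryPair hS hS' (hbdd ε hε) hε (hmean ε hε) (hτ ε hε)
  have hfst (π : Measure (Fin 2 → ℝ)) [IsProbabilityMeasure π] (ε : ℝ) :
      (π ⊗ₘ τ ε).map Prod.fst = π := Measure.fst_compProd π (τ ε)
  refine ⟨fun ε hε => exists_isSteadyState hS hS' (hbdd ε hε) hε.1 (hmean ε hε) (hτ ε hε),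
    fun π hπ => ⟨fun ε hε i => ?_, ?_⟩⟩
  · have := (hπ ε hε).1
    have h1 := (hpair π hπ ε hε).integrable i
    rw [← hfst (π ε) ε]
    exact (integrable_map_measure (measurable_pi_apply i).aestronglyMeasurable
      measurable_fst.aemeasurable).mpr h1
  · have hv := ((hvar 0).add (hvar 1)).const_mul (3 / 4)
    have hε0 : Tendsto (fun ε : ℝ => (12 + 4 * (3 * ((Amax : ℝ) + 1)) ^ 2) * ε) (𝓝[>] 0)
        (𝓝 0) := by
      have : Tendsto (fun ε : ℝ => (12 + 4 * (3 * ((Amax : ℝ) + 1)) ^ 2) * ε) (𝓝 0)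
        (𝓝 ((12 + 4 * (3 * ((Amax : ℝ) + 1)) ^ 2) * 0)) := tendsto_id.const_mul _
      rw [mul_zero] at this
      exact this.mono_left nhdsWithin_le_nhds
    -- The error constant depends only on `Amax`, so the bound is uniform in `ε`.
    have hdiff : Tendsto (fun ε : ℝ => ε * ∫ q, (q 0 + q 1) ∂(π ε) - 3 / 4 *
        (variance (fun a : Fin 2 → ℕ => (a 0 : ℝ)) (α ε) +
          variance (fun a : Fin 2 → ℕ => (a 1 : ℝ)) (α ε))) (𝓝[>] 0) (𝓝 0) := by
      refine squeeze_zero_norm' ?_ hε0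
      filter_upwards [Ioo_mem_nhdsGT (zero_lt_one' ℝ)] with ε hε
      have := (hπ ε hε).1
      have h1 := (hpair π hπ ε hε).abs_sub_le
      have h2 : ∫ q, (q 0 + q 1) ∂(π ε) = ∫ p, (p.1 0 + p.1 1) ∂(π ε ⊗ₘ τ ε) := by
        conv_lhs => rw [← hfst (π ε) ε]
        exact integral_map measurable_fst.aemeasurable (by fun_prop)
      rwa [h2, Real.norm_eq_abs]
    simpa using hdiff.add hv
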